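/- Let $\mathcal M\subset\mathbb R^D$ be a compact, connected, smoothly embedded $d$-dimensional submanifold (without boundary; it is then automatically geodesically complete). Let $d_{\mathcal M}(x,y)$ denote the intrinsic distance on $\mathcal M$, i.e. the infimum of the lengths of $C^1$ curves in $\mathcal M$ joining $x$ to $y$, and let $d(x,\mathcal M)=\inf_{y\in\mathcal M}\|x-y\|_2$. Suppose that the extrinsic curvature of $\mathcal M$ is bounded by $\kappa$, i.e. the second fundamental form of $\mathcal M$ satisfies $\|\mathrm{I\!I}_p(v,w)\|_2\le\kappa\,\|v\|_2\,\|w\|_2$ for all $p\in\mathcal M$ and $v,w\in T_p\mathcal M$. Let $N\ge 1$, let $x_{1\natural},\dots,x_{N\natural}\in\mathcal M$, and let $q_\natural$ be an arbitrary point of $\mathcal M$. Then \[ d\Bigl(\frac1N\sum_{i=1}^N x_{i\natural},\;\mathcal M\Bigr)\;\le\;\frac{\kappa}{N}\sum_{i=1}^N d_{\mathcal M}^2\bigl(x_{i\natural},q_\natural\bigr). \] -/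

import Mathlib

open scoped Topology ContDiff

/-- `M ⊆ ℝ^D` is a smooth embedded `d`-dimensional submanifold (without boundary): around each of
its points there is a smooth slice chart, i.e. a diffeomorphism `e` between open subsets of `ℝ^D`
that takes `M` to a `d`-dimensional linear subspace. -/
def IsSmoothSubmanifold {D : ℕ} (d : ℕ) (M : Set (EuclideanSpace ℝ (Fin D))) : Prop :=
  ∀ p ∈ M, ∃ (e : OpenPartialHomeomorph (EuclideanSpace ℝ (Fin D)) (EuclideanSpace ℝ (Fin D)))
    (V : Submodule ℝ (EuclideanSpace ℝ (Fin D))),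
    p ∈ e.source ∧ ContDiffOn ℝ ∞ e e.source ∧ ContDiffOn ℝ ∞ e.symm e.target ∧
      Module.finrank ℝ V = d ∧ ∀ x ∈ e.source, (x ∈ M ↔ e x ∈ V)

/-- The tangent space `T_p M`: the velocities at `p` of curves in `M` through `p`.
For a submanifold these already form a linear subspace. -/
def submanifoldTangent {D : ℕ} (M : Set (EuclideanSpace ℝ (Fin D)))
    (p : EuclideanSpace ℝ (Fin D)) : Submodule ℝ (EuclideanSpace ℝ (Fin D)) :=
  Submodule.span ℝ {v | ∃ γ : ℝ → EuclideanSpace ℝ (Fin D),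
    γ 0 = p ∧ (∀ᶠ t in 𝓝 (0 : ℝ), γ t ∈ M) ∧ HasDerivAt γ v 0}

/-- `II_p(v, w) = n`, where `II` is the second fundamental form of `M`: `n` is the component
normal to `M` of the derivative at time `0` of a tangent vector field `W` along a curve `γ` in `M`,
where `γ` passes through `p` with velocity `v` and `W` starts at `w`. On a submanifold, `n` depends
only on `p`, `v` and `w` (and smooth choices of `γ` and `W` give the same value). -/
def IsSecondFundamentalForm {D : ℕ} (M : Set (EuclideanSpace ℝ (Fin D)))
    (p v w n : EuclideanSpace ℝ (Fin D)) : Prop :=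
  ∃ (γ W : ℝ → EuclideanSpace ℝ (Fin D)) (a : EuclideanSpace ℝ (Fin D)),
    γ 0 = p ∧ (∀ᶠ t in 𝓝 (0 : ℝ), γ t ∈ M) ∧ HasDerivAt γ v 0 ∧
    W 0 = w ∧ (∀ᶠ t in 𝓝 (0 : ℝ), W t ∈ submanifoldTangent M (γ t)) ∧ HasDerivAt W a 0 ∧
    n = (submanifoldTangent M p)ᗮ.starProjection a

/-- The extrinsic curvature of `M` is bounded by `κ`: the second fundamental form satisfies
`‖II_p(v, w)‖ ≤ κ ‖v‖ ‖w‖` for all `p ∈ M` and all tangent vectors `v`, `w` at `p`. -/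
def ExtrinsicCurvatureBounded {D : ℕ} (M : Set (EuclideanSpace ℝ (Fin D))) (κ : ℝ) : Prop :=
  ∀ p ∈ M, ∀ v w n : EuclideanSpace ℝ (Fin D),
    IsSecondFundamentalForm M p v w n → ‖n‖ ≤ κ * ‖v‖ * ‖w‖

/-- The intrinsic distance `d_M(x, y)`: the infimum of the lengths of `C¹` curves in `M`
from `x` to `y`. -/
noncomputable def intrinsicDist {D : ℕ} (M : Set (EuclideanSpace ℝ (Fin D)))
    (x y : EuclideanSpace ℝ (Fin D)) : ℝ :=
  sInf {L | ∃ γ : ℝ → EuclideanSpace ℝ (Fin D),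
    ContDiffOn ℝ 1 γ (Set.Icc 0 1) ∧ (∀ t ∈ Set.Icc (0 : ℝ) 1, γ t ∈ M) ∧ γ 0 = x ∧ γ 1 = y ∧
      L = ∫ t in (0 : ℝ)..1, ‖derivWithin γ (Set.Icc 0 1) t‖}

/-! Write `δ i` for the intrinsic distance from `x i` to `q`, and `v` for the mean of the tangential
parts of `x i - q` at `q`. The mean of the `x i` differs from `q + v` by the mean of the normal
parts, each at most `κ / 2 * δ i ^ 2` (`norm_normal_le_intrinsicDist`). The point `q + v` lies
within `κ / 2 * ‖v‖ ^ 2` of `M` (`infDist_add_tangent_le`), and `‖v‖ ^ 2` is at most the mean of the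
`δ i ^ 2` by Cauchy–Schwarz. The two halves add up to `κ`.

Both bounds come from one fact: the orthogonal projection onto the tangent space has derivative of
norm at most `κ * ‖v‖` in a tangent direction `v`. That derivative is off-diagonal for the splitting
into tangent and normal space, its blocks being the second fundamental form and its adjoint. -/

open scoped RealInnerProductSpace InnerProduct

/-! ### Differentiability of the projection onto the range of an injective map. -/

section Projections

variable {F E : Type*} [NormedAddCommGroup F] [InnerProductSpace ℝ F] [CompleteSpace F]
  [NormedAddCommGroup E] [InnerProductSpace ℝ E] [CompleteSpace E]

theorem ContinuousLinearMap.isBoundedLinearMap_adjoint :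
    IsBoundedLinearMap ℝ (fun S : F →L[ℝ] E => S.adjoint) :=
  IsLinearMap.with_bound ⟨fun x y => map_add _ x y, fun c x => by simp⟩ 1 fun x => by simp

variable [FiniteDimensional ℝ F]

theorem isUnit_adjoint_comp_self_of_injective (S : F →L[ℝ] E)
    (hS : Function.Injective S) : IsUnit (S.adjoint ∘L S) := by
  have hk : LinearMap.ker (S.adjoint ∘L S).toLinearMap = ⊥ := by
    rw [LinearMap.ker_eq_bot']
    intro v hv
    have h1 : ⟪S v, S v⟫ = 0 := by
      rw [← ContinuousLinearMap.adjoint_inner_left]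
      have : (S.adjoint) (S v) = 0 := hv
      rw [this, inner_zero_left]
    exact hS (by rw [inner_self_eq_zero.1 h1, map_zero])
  exact ContinuousLinearMap.isUnit_iff_bijective.2
    ⟨LinearMap.ker_eq_bot.1 hk,
      LinearMap.range_eq_top.1 (LinearMap.ker_eq_bot_iff_range_eq_top.1 hk)⟩

/-- The normal equations of least squares: the residual is killed by `S.adjoint`. The formula shows
that the projection depends differentiably on `S`. -/
theorem starProjection_range_of_injective (S : F →L[ℝ] E)
    (hS : Function.Injective S) :
    (LinearMap.range S.toLinearMap).starProjection =
      S ∘L Ring.inverse (S.adjoint ∘L S) ∘L S.adjoint := by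
  ext z
  apply Submodule.eq_starProjection_of_mem_of_inner_eq_zero
  · exact ⟨_, rfl⟩
  · rintro _ ⟨w, rfl⟩
    have h := Ring.mul_inverse_cancel _ (isUnit_adjoint_comp_self_of_injective S hS)
    have h2 := congrArg (fun A : F →L[ℝ] F => A (S.adjoint z)) h
    simp only [mul_apply_eq_comp, ContinuousLinearMap.comp_apply,
      one_apply_eq_self] at h2
    rw [ContinuousLinearMap.coe_coe, ← ContinuousLinearMap.adjoint_inner_left, map_sub]
    simp only [ContinuousLinearMap.comp_apply]
    rw [h2, sub_self, inner_zero_left]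

theorem differentiableAt_starProjection_range {X : Type*} [NormedAddCommGroup X] [NormedSpace ℝ X]
    {S : X → F →L[ℝ] E} {x : X} (hS : DifferentiableAt ℝ S x)
    (hinj : ∀ᶠ y in 𝓝 x, Function.Injective (S y)) :
    DifferentiableAt ℝ (fun y => (LinearMap.range (S y).toLinearMap).starProjection) x := by
  have hadj : DifferentiableAt ℝ (fun y => (S y).adjoint) x :=
    ContinuousLinearMap.isBoundedLinearMap_adjoint.differentiableAt.comp x hS
  have hinv : DifferentiableAt ℝ (fun y => Ring.inverse ((S y).adjoint ∘L S y)) x :=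
    DifferentiableAt.comp (g := Ring.inverse) (f := fun y => (S y).adjoint ∘L S y) x
      (differentiableAt_inverse (isUnit_adjoint_comp_self_of_injective _ hinj.self_of_nhds))
      (hadj.clm_comp hS)
  refine (hS.clm_comp (hinv.clm_comp hadj)).congr_of_eventuallyEq ?_
  filter_upwards [hinj] with y hy using starProjection_range_of_injective _ hy

end Projections

/-! ### Norm of the derivative of a family of projections. -/

section ProjectionDerivative

variable {E : Type*} [NormedAddCommGroup E] [InnerProductSpace ℝ E] [FiniteDimensional ℝ E]

/-- The derivative of a family of orthogonal projections is determined by its off-diagonal block. -/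
theorem norm_apply_le_of_projection_deriv (K : Submodule ℝ E) (B : E →L[ℝ] E) {c : ℝ} (hc : 0 ≤ c)
    (hB : ∀ z, B z = B (K.starProjection z) + K.starProjection (B z))
    (hsym : ∀ y z, ⟪B y, z⟫ = ⟪y, B z⟫)
    (h : ∀ w ∈ K, ‖Kᗮ.starProjection (B w)‖ ≤ c * ‖w‖) : ‖B‖ ≤ c := by
  have hK : ∀ w ∈ K, ‖B w‖ ≤ c * ‖w‖ ∧ B w ∈ Kᗮ := by
    intro w hw
    have h1 := hB w
    rw [Submodule.starProjection_eq_self_iff.2 hw] at h1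
    have h2 : K.starProjection (B w) = 0 := by simpa using h1
    have h3 := h w hw
    rw [Submodule.starProjection_orthogonal_val, h2, sub_zero] at h3
    exact ⟨h3, (Submodule.starProjection_apply_eq_zero_iff K).1 h2⟩
  -- On `Kᗮ`, `B` is the adjoint of its restriction to `K`, so it inherits the bound.
  have hK' : ∀ u ∈ Kᗮ, ‖B u‖ ≤ c * ‖u‖ ∧ B u ∈ K := by
    intro u hu
    have h1 := hB u
    rw [(Submodule.starProjection_apply_eq_zero_iff K).2 hu, map_zero, zero_add] at h1
    have h2 : B u ∈ K := Submodule.starProjection_eq_self_iff.1 h1.symm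
    refine ⟨?_, h2⟩
    have h3 : ‖B u‖ * ‖B u‖ ≤ c * ‖u‖ * ‖B u‖ := by
      rw [← real_inner_self_eq_norm_mul_norm, hsym]
      calc _ ≤ ‖u‖ * ‖B (B u)‖ := real_inner_le_norm _ _
        _ ≤ ‖u‖ * (c * ‖B u‖) := by gcongr; exact (hK _ h2).1
        _ = _ := by ring
    rcases (norm_nonneg (B u)).eq_or_lt with h0 | h0
    · rw [← h0]; positivity
    · exact le_of_mul_le_mul_right h3 h0
  refine B.opNorm_le_bound hc fun z => ?_
  set w := K.starProjection z with hwdef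
  set u := Kᗮ.starProjection z with hudef
  have hwm : w ∈ K := Submodule.starProjection_apply_mem _ _
  have hum : u ∈ Kᗮ := Submodule.starProjection_apply_mem _ _
  have hz : z = w + u := by
    rw [hudef, Submodule.starProjection_orthogonal_val]; abel
  have e1 : ‖z‖ ^ 2 = ‖w‖ ^ 2 + ‖u‖ ^ 2 := by
    rw [hz, norm_add_sq_real, Submodule.inner_right_of_mem_orthogonal hwm hum]; ring
  have e2 : ‖B z‖ ^ 2 = ‖B w‖ ^ 2 + ‖B u‖ ^ 2 := by
    rw [hz, map_add, norm_add_sq_real,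
      Submodule.inner_left_of_mem_orthogonal (hK' u hum).2 (hK w hwm).2]; ring
  refine le_of_sq_le_sq ?_ (by positivity)
  rw [e2, mul_pow, e1]
  have b1 := pow_le_pow_left₀ (norm_nonneg _) (hK w hwm).1 2
  have b2 := pow_le_pow_left₀ (norm_nonneg _) (hK' u hum).1 2
  rw [mul_pow] at b1 b2
  linarith

/-- Differentiating `P * P = P` and the symmetry of `P` yields the two algebraic identities for `B`.
-/
theorem norm_deriv_starProjection_le {T : ℝ → Submodule ℝ E} {B : E →L[ℝ] E} {c : ℝ} (hc : 0 ≤ c)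
    (hT : HasDerivAt (fun t => (T t).starProjection) B 0)
    (h : ∀ w ∈ T 0, ‖(T 0)ᗮ.starProjection (B w)‖ ≤ c * ‖w‖) : ‖B‖ ≤ c := by
  have hz : ∀ z, HasDerivAt (fun t => (T t).starProjection z) (B z) 0 := fun z => by
    simpa using hT.clm_apply (hasDerivAt_const 0 z)
  refine norm_apply_le_of_projection_deriv (T 0) B hc (fun z => ?_) (fun y z => ?_) h
  · have h2 := hT.clm_apply (hz z)
    refine (hz z).unique (h2.congr_of_eventuallyEq (Filter.Eventually.of_forall fun t => ?_))
    exact (Submodule.starProjection_eq_self_iff.2 (Submodule.starProjection_apply_mem _ _)).symm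
  · have h1 := (hz y).inner ℝ (hasDerivAt_const 0 z)
    have h2 := (hasDerivAt_const 0 y).inner ℝ (hz z)
    have h3 := h1.unique (h2.congr_of_eventuallyEq (Filter.Eventually.of_forall fun t =>
      Submodule.inner_starProjection_left_eq_right _ _ _))
    simpa using h3

end ProjectionDerivative

/-! ### Tangent spaces in slice charts and the derivative of the tangent projection. -/

section SliceCharts

variable {D d : ℕ} {M : Set (EuclideanSpace ℝ (Fin D))} {κ : ℝ}

/-- A diffeomorphism between open subsets of `ℝ^D` flattening `M` to the linear subspace `V`. -/
structure IsSliceChart (M : Set (EuclideanSpace ℝ (Fin D)))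
    (e : OpenPartialHomeomorph (EuclideanSpace ℝ (Fin D)) (EuclideanSpace ℝ (Fin D)))
    (V : Submodule ℝ (EuclideanSpace ℝ (Fin D))) : Prop where
  contDiffOn : ContDiffOn ℝ ∞ e e.source
  contDiffOn_symm : ContDiffOn ℝ ∞ e.symm e.target
  mem_iff : ∀ x ∈ e.source, (x ∈ M ↔ e x ∈ V)

theorem IsSmoothSubmanifold.exists_isSliceChart (hM : IsSmoothSubmanifold d M)
    {p : EuclideanSpace ℝ (Fin D)} (hp : p ∈ M) :
    ∃ e V, IsSliceChart M e V ∧ p ∈ e.source := by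
  obtain ⟨e, V, h1, h2, h3, -, h4⟩ := hM p hp
  exact ⟨e, V, ⟨h2, h3, h4⟩, h1⟩

namespace IsSliceChart

variable {e : OpenPartialHomeomorph (EuclideanSpace ℝ (Fin D)) (EuclideanSpace ℝ (Fin D))}
  {V : Submodule ℝ (EuclideanSpace ℝ (Fin D))} {y v : EuclideanSpace ℝ (Fin D)}

theorem symm_mem (h : IsSliceChart M e V) {z : EuclideanSpace ℝ (Fin D)} (hz : z ∈ e.target)
    (hzV : z ∈ V) : e.symm z ∈ M := by
  rw [h.mem_iff _ (e.map_target hz), e.right_inv hz]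
  exact hzV

theorem hasFDerivAt (h : IsSliceChart M e V) (hy : y ∈ e.source) :
    HasFDerivAt e (fderiv ℝ e y) y :=
  ((h.contDiffOn.contDiffAt (e.open_source.mem_nhds hy)).differentiableAt (by simp)).hasFDerivAt

theorem hasFDerivAt_symm (h : IsSliceChart M e V) (hy : y ∈ e.source) :
    HasFDerivAt e.symm (fderiv ℝ e.symm (e y)) (e y) :=
  ((h.contDiffOn_symm.contDiffAt (e.open_target.mem_nhds (e.map_source hy))).differentiableAt
    (by simp)).hasFDerivAt

theorem fderiv_symm_fderiv (h : IsSliceChart M e V) (hy : y ∈ e.source)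
    (v : EuclideanSpace ℝ (Fin D)) : fderiv ℝ e.symm (e y) (fderiv ℝ e y v) = v := by
  have h1 := (h.hasFDerivAt_symm hy).comp y (h.hasFDerivAt hy)
  have h2 := h1.unique ((hasFDerivAt_id y).congr_of_eventuallyEq
    (Filter.eventually_of_mem (e.open_source.mem_nhds hy) fun z hz => e.left_inv hz))
  exact congrArg (fun A : EuclideanSpace ℝ (Fin D) →L[ℝ] EuclideanSpace ℝ (Fin D) => A v) h2

theorem fderiv_fderiv_symm (h : IsSliceChart M e V) (hy : y ∈ e.source)
    (v : EuclideanSpace ℝ (Fin D)) : fderiv ℝ e y (fderiv ℝ e.symm (e y) v) = v := by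
  have h0 := h.hasFDerivAt hy
  rw [← e.left_inv hy] at h0
  have h1 := h0.comp (e y) (h.hasFDerivAt_symm hy)
  have h2 := h1.unique ((hasFDerivAt_id (e y)).congr_of_eventuallyEq
    (Filter.eventually_of_mem (e.open_target.mem_nhds (e.map_source hy))
      fun z hz => e.right_inv hz))
  have h3 := congrArg (fun A : EuclideanSpace ℝ (Fin D) →L[ℝ] EuclideanSpace ℝ (Fin D) => A v) h2
  rw [e.left_inv hy] at h3
  exact h3

/-- The difference quotients of `e ∘ γ` lie in the closed subspace `V`. The derivative is taken
within `s` to cover the endpoints of a curve on `[0, 1]`. -/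
theorem fderiv_mem_of_hasDerivWithinAt (h : IsSliceChart M e V) {γ : ℝ → EuclideanSpace ℝ (Fin D)}
    {s : Set ℝ} {t : ℝ} (hγ : HasDerivWithinAt γ v s t) (hs : UniqueDiffWithinAt ℝ s t)
    (ht : t ∈ s) (hγM : ∀ᶠ r in 𝓝[s] t, γ r ∈ M) (hsrc : γ t ∈ e.source) :
    fderiv ℝ e (γ t) v ∈ V := by
  have h1 := (h.hasFDerivAt hsrc).comp_hasDerivWithinAt t hγ
  rw [hasDerivWithinAt_iff_tendsto_slope] at h1
  have : (𝓝[s \ {t}] t).NeBot :=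
    accPt_principal_iff_nhdsWithin.1 (uniqueDiffWithinAt_iff_accPt.1 hs)
  have hV : ∀ᶠ r in 𝓝[s] t, e (γ r) ∈ V := by
    filter_upwards [hγM, hγ.continuousWithinAt (e.open_source.mem_nhds hsrc)] with r h1 h2
    exact (h.mem_iff _ h2).1 h1
  refine (Submodule.closed_of_finiteDimensional V).mem_of_tendsto h1 ?_
  filter_upwards [hV.filter_mono (nhdsWithin_mono _ Set.sdiff_subset)] with r hr
  exact V.smul_mem _ (V.sub_mem hr (hV.self_of_nhdsWithin ht))

/-- A straight line in `V` is pulled back through the chart. -/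
theorem exists_curve (h : IsSliceChart M e V) (hyM : y ∈ M) (hy : y ∈ e.source)
    (hv : fderiv ℝ e y v ∈ V) : ∃ γ : ℝ → EuclideanSpace ℝ (Fin D),
      γ 0 = y ∧ (∀ᶠ t in 𝓝 (0 : ℝ), γ t ∈ M) ∧ HasDerivAt γ v 0 := by
  have hl : HasDerivAt (fun t : ℝ => e y + t • fderiv ℝ e y v) (fderiv ℝ e y v) 0 := by
    simpa using ((hasDerivAt_id (0 : ℝ)).smul_const (fderiv ℝ e y v)).const_add (e y)
  have h0 : e y + (0 : ℝ) • fderiv ℝ e y v = e y := by simp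
  refine ⟨fun t => e.symm (e y + t • fderiv ℝ e y v), by simp [e.left_inv hy], ?_, ?_⟩
  · have : ∀ᶠ t in 𝓝 (0 : ℝ), e y + t • fderiv ℝ e y v ∈ e.target :=
      hl.continuousAt (e.open_target.mem_nhds (by rw [h0]; exact e.map_source hy))
    filter_upwards [this] with t ht
    exact h.symm_mem ht (V.add_mem ((h.mem_iff y hy).1 hyM) (V.smul_mem _ hv))
  · have h1 := h.hasFDerivAt_symm hy
    rw [← h0] at h1
    have h2 := h1.comp_hasDerivAt (0 : ℝ) hl
    rwa [h0, h.fderiv_symm_fderiv hy] at h2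

theorem mem_tangent_iff (h : IsSliceChart M e V) (hyM : y ∈ M) (hy : y ∈ e.source) :
    v ∈ submanifoldTangent M y ↔ fderiv ℝ e y v ∈ V := by
  refine ⟨fun hv => ?_, fun hv => Submodule.subset_span (h.exists_curve hyM hy hv)⟩
  have : submanifoldTangent M y ≤ V.comap (fderiv ℝ e y).toLinearMap := by
    refine Submodule.span_le.2 ?_
    rintro w ⟨γ, rfl, hγM, hγ⟩
    exact h.fderiv_mem_of_hasDerivWithinAt hγ.hasDerivWithinAt uniqueDiffWithinAt_univ
      (Set.mem_univ _) (by rwa [nhdsWithin_univ]) hy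
  exact this hv

theorem tangent_eq_range (h : IsSliceChart M e V) (hyM : y ∈ M) (hy : y ∈ e.source) :
    submanifoldTangent M y =
      LinearMap.range (fderiv ℝ e.symm (e y) ∘L V.subtypeL).toLinearMap := by
  ext v
  rw [h.mem_tangent_iff hyM hy]
  constructor
  · intro hv
    exact ⟨⟨_, hv⟩, h.fderiv_symm_fderiv hy v⟩
  · rintro ⟨w, rfl⟩
    simp [h.fderiv_fderiv_symm hy]

theorem differentiableWithinAt_starProjection (h : IsSliceChart M e V) (hyM : y ∈ M)
    (hy : y ∈ e.source) :
    DifferentiableWithinAt ℝ (fun z => (submanifoldTangent M z).starProjection) M y := by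
  have h1 : DifferentiableAt ℝ (fun z => fderiv ℝ e.symm (e z) ∘L V.subtypeL) y := by
    have h2 : DifferentiableAt ℝ (fderiv ℝ e.symm) (e y) :=
      ((h.contDiffOn_symm.contDiffAt (e.open_target.mem_nhds (e.map_source hy))).fderiv_right
        (m := 1) (by norm_cast)).differentiableAt (by simp)
    exact (h2.comp y (h.hasFDerivAt hy).differentiableAt).clm_comp (differentiableAt_const _)
  have h3 : ∀ᶠ z in 𝓝 y, z ∈ e.source := e.open_source.mem_nhds hy
  have h4 := differentiableAt_starProjection_range h1 (by
    filter_upwards [h3] with z hz a b hab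
    have := congrArg (fderiv ℝ e z) hab
    simpa [h.fderiv_fderiv_symm hz] using this)
  -- The range formula describes the tangent space only at points of `M`, hence a derivative within
  -- `M`.
  refine h4.differentiableWithinAt.congr_of_eventuallyEq_of_mem ?_ hyM
  filter_upwards [nhdsWithin_le_nhds h3, self_mem_nhdsWithin] with z hz hzM
  rw [h.tangent_eq_range hzM hz]

end IsSliceChart

theorem IsSmoothSubmanifold.exists_curve (hM : IsSmoothSubmanifold d M)
    {y v : EuclideanSpace ℝ (Fin D)} (hy : y ∈ M) (hv : v ∈ submanifoldTangent M y) :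
    ∃ γ : ℝ → EuclideanSpace ℝ (Fin D),
      γ 0 = y ∧ (∀ᶠ t in 𝓝 (0 : ℝ), γ t ∈ M) ∧ HasDerivAt γ v 0 := by
  obtain ⟨e, V, h, hs⟩ := hM.exists_isSliceChart hy
  exact h.exists_curve hy hs ((h.mem_tangent_iff hy hs).1 hv)

theorem IsSmoothSubmanifold.mem_tangent_of_hasDerivWithinAt (hM : IsSmoothSubmanifold d M)
    {γ : ℝ → EuclideanSpace ℝ (Fin D)} {v : EuclideanSpace ℝ (Fin D)} {s : Set ℝ} {t : ℝ}
    (hγ : HasDerivWithinAt γ v s t) (hs : UniqueDiffWithinAt ℝ s t) (ht : t ∈ s)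
    (hγM : ∀ r ∈ s, γ r ∈ M) : v ∈ submanifoldTangent M (γ t) := by
  obtain ⟨e, V, h, hsrc⟩ := hM.exists_isSliceChart (hγM t ht)
  exact (h.mem_tangent_iff (hγM t ht) hsrc).2 (h.fderiv_mem_of_hasDerivWithinAt hγ hs ht
    (Filter.eventually_of_mem self_mem_nhdsWithin hγM) hsrc)

/-- `B` is the derivative of `Π` along `M`, where `Π` maps a point of `M` to the orthogonal
projection onto its tangent space. -/
theorem IsSmoothSubmanifold.exists_hasFDerivWithinAt_starProjection
    (hM : IsSmoothSubmanifold d M) (hκ : ExtrinsicCurvatureBounded M κ)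
    {y : EuclideanSpace ℝ (Fin D)} (hy : y ∈ M) :
    ∃ B : EuclideanSpace ℝ (Fin D) →L[ℝ] EuclideanSpace ℝ (Fin D) →L[ℝ] EuclideanSpace ℝ (Fin D),
      HasFDerivWithinAt (fun z => (submanifoldTangent M z).starProjection) B M y ∧
      ∀ v ∈ submanifoldTangent M y, ‖B v‖ ≤ κ * ‖v‖ := by
  obtain ⟨e, V, h, hs⟩ := hM.exists_isSliceChart hy
  have hB := (h.differentiableWithinAt_starProjection hy hs).hasFDerivWithinAt
  refine ⟨_, hB, fun v hv => ?_⟩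
  set B := fderivWithin ℝ (fun z => (submanifoldTangent M z).starProjection) M y
  obtain ⟨γ, rfl, hγM, hγ⟩ := hM.exists_curve hy hv
  have hP : HasDerivAt (fun t => (submanifoldTangent M (γ t)).starProjection) (B v) 0 :=
    hB.comp_hasDerivAt_of_eq 0 hγ hγM rfl
  -- Projecting a fixed `w` onto the moving tangent space gives a tangent field with derivative `B v
  -- w`, whose normal part is a value of the second fundamental form.
  have hII : ∀ w ∈ submanifoldTangent M (γ 0),
      ‖(submanifoldTangent M (γ 0))ᗮ.starProjection (B v w)‖ ≤ κ * ‖v‖ * ‖w‖ := fun w hw =>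
    hκ (γ 0) hy v w _ ⟨γ, fun t => (submanifoldTangent M (γ t)).starProjection w, B v w, rfl, hγM,
      hγ, Submodule.starProjection_eq_self_iff.2 hw,
      Filter.Eventually.of_forall fun t => Submodule.starProjection_apply_mem _ _,
      by simpa using hP.clm_apply (hasDerivAt_const 0 w), rfl⟩
  rcases eq_or_ne v 0 with rfl | hv0
  · simp
  -- No sign of `κ` is assumed: the curvature bound at `w = v ≠ 0` forces this one.
  · have h0 : 0 ≤ κ * ‖v‖ :=
      nonneg_of_mul_nonneg_left ((norm_nonneg _).trans (hII v hv)) (norm_pos_iff.2 hv0)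
    exact norm_deriv_starProjection_le h0 hP hII

end SliceCharts

/-! ### Curves in `M` against the tangent space: deviation, and approximation of `q + v`. -/

section Curves

variable {D d : ℕ} {M : Set (EuclideanSpace ℝ (Fin D))} {κ : ℝ}

theorem hasDerivAt_integral_of_continuous {u : ℝ → ℝ} (hu : Continuous u) (t : ℝ) :
    HasDerivAt (fun t => ∫ s in (0 : ℝ)..t, u s) (u t) t :=
  (hu.integral_hasStrictDerivAt 0 t).hasDerivAt

/-- A curve in `M` deviates from the tangent space at its starting point by at most
`κ / 2` times its squared length. -/
theorem norm_sub_le_and_norm_normal_le (hM : IsSmoothSubmanifold d M)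
    (hκ : ExtrinsicCurvatureBounded M κ) {γ γ' : ℝ → EuclideanSpace ℝ (Fin D)} {u : ℝ → ℝ}
    (hγ : ∀ t ∈ Set.Icc (0 : ℝ) 1, HasDerivWithinAt γ (γ' t) (Set.Icc 0 1) t)
    (hγM : ∀ t ∈ Set.Icc (0 : ℝ) 1, γ t ∈ M) (hu : Continuous u)
    (hle : ∀ t ∈ Set.Icc (0 : ℝ) 1, ‖γ' t‖ = u t) :
    ‖γ 1 - γ 0‖ ≤ ∫ t in (0 : ℝ)..1, u t ∧
      ‖(submanifoldTangent M (γ 0))ᗮ.starProjection (γ 1 - γ 0)‖ ≤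
        κ / 2 * (∫ t in (0 : ℝ)..1, u t) ^ 2 := by
  set ℓ : ℝ → ℝ := fun t => ∫ s in (0 : ℝ)..t, u s with hℓdef
  have hℓ := hasDerivAt_integral_of_continuous hu
  have hℓ0 : ℓ 0 = 0 := by simp [hℓdef]
  have hright : ∀ t ∈ Set.Ico (0 : ℝ) 1, Set.Icc (0 : ℝ) 1 ∈ 𝓝[≥] t := fun t ht =>
    Icc_mem_nhdsGE_of_mem ht
  have hcont : ContinuousOn γ (Set.Icc 0 1) := fun t ht => (hγ t ht).continuousWithinAt
  have h1 : (1 : ℝ) ∈ Set.Icc (0 : ℝ) 1 := by simp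
  have h0 : (0 : ℝ) ∈ Set.Icc (0 : ℝ) 1 := by simp
  have htan : ∀ t ∈ Set.Icc (0 : ℝ) 1, γ' t ∈ submanifoldTangent M (γ t) := fun t ht =>
    hM.mem_tangent_of_hasDerivWithinAt (hγ t ht) (uniqueDiffOn_Icc zero_lt_one t ht) ht hγM
  set P : ℝ → EuclideanSpace ℝ (Fin D) →L[ℝ] EuclideanSpace ℝ (Fin D) :=
    fun t => (submanifoldTangent M (γ t)).starProjection with hPdef
  have hP : ∀ t ∈ Set.Icc (0 : ℝ) 1, ∃ P', HasDerivWithinAt P P' (Set.Icc 0 1) t ∧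
      ‖P'‖ ≤ κ * u t := by
    intro t ht
    obtain ⟨B, hB, hBle⟩ := hM.exists_hasFDerivWithinAt_starProjection hκ (hγM t ht)
    exact ⟨B (γ' t), hB.comp_hasDerivWithinAt t (hγ t ht) hγM, by
      rw [← hle t ht]; exact hBle _ (htan t ht)⟩
  choose! P' hP' hP'le using hP
  have hPℓ : ∀ t ∈ Set.Icc (0 : ℝ) 1, ‖P t - P 0‖ ≤ κ * ℓ t := by
    refine image_norm_le_of_norm_deriv_right_le_deriv_boundary (f' := P')
      (B' := fun t => κ * u t)
      (fun t ht => ((hP' t ht).sub_const _).continuousWithinAt) (fun t ht => ?_) ?_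
      (fun t => (hℓ t).const_mul κ) (fun t ht => hP'le t ⟨ht.1, ht.2.le⟩)
    · exact ((hP' t ⟨ht.1, ht.2.le⟩).sub_const _).mono_of_mem_nhdsWithin (hright t ht)
    · simp [hℓ0]
  constructor
  · refine image_norm_le_of_norm_deriv_right_le_deriv_boundary (f := fun t => γ t - γ 0) (f' := γ')
      (B' := u) (hcont.sub continuousOn_const) (fun t ht => ?_) ?_ hℓ
      (fun t ht => (hle t ⟨ht.1, ht.2.le⟩).le) h1
    · exact ((hγ t ⟨ht.1, ht.2.le⟩).sub_const _).mono_of_mem_nhdsWithin (hright t ht)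
    · simp
  · set Q := (submanifoldTangent M (γ 0))ᗮ.starProjection
    refine image_norm_le_of_norm_deriv_right_le_deriv_boundary (f := fun t => Q (γ t - γ 0))
      (f' := fun t => Q (γ' t)) (B := fun t => κ / 2 * ℓ t ^ 2)
      (B' := fun t => κ * ℓ t * u t)
      (Q.continuous.comp_continuousOn (hcont.sub continuousOn_const)) (fun t ht => ?_) ?_
      (fun t => ?_) (fun t ht => ?_) h1
    · exact Q.hasFDerivAt.comp_hasDerivWithinAt t
        (((hγ t ⟨ht.1, ht.2.le⟩).sub_const _).mono_of_mem_nhdsWithin (hright t ht))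
    · simp [hℓ0]
    · refine (((hℓ t).pow 2).const_mul (κ / 2)).congr_deriv ?_
      norm_num
      ring
    · have ht' : t ∈ Set.Icc (0 : ℝ) 1 := ⟨ht.1, ht.2.le⟩
      -- Since `γ' t` is tangent at `γ t`, its component normal at `γ 0` measures only the rotation
      -- of the tangent space. It is at most `κ * ℓ t * u t`, the derivative of `κ / 2 * ℓ t ^ 2`.
      have hQ : Q (γ' t) = (P t - P 0) (γ' t) := by
        rw [Submodule.starProjection_orthogonal_val, sub_apply, hPdef]
        simp only
        rw [Submodule.starProjection_eq_self_iff.2 (htan t ht')]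
      rw [hQ, ← hle t ht']
      exact ContinuousLinearMap.le_of_opNorm_le _ (hPℓ t ht') _

/-- The set of lengths of `C¹` curves in `M` from `x` to `y`. -/
def curveLengths (M : Set (EuclideanSpace ℝ (Fin D))) (x y : EuclideanSpace ℝ (Fin D)) : Set ℝ :=
  {L | ∃ γ : ℝ → EuclideanSpace ℝ (Fin D),
    ContDiffOn ℝ 1 γ (Set.Icc 0 1) ∧ (∀ t ∈ Set.Icc (0 : ℝ) 1, γ t ∈ M) ∧ γ 0 = x ∧ γ 1 = y ∧
      L = ∫ t in (0 : ℝ)..1, ‖derivWithin γ (Set.Icc 0 1) t‖}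

theorem norm_sub_le_of_mem_curveLengths (hM : IsSmoothSubmanifold d M)
    (hκ : ExtrinsicCurvatureBounded M κ) {x q : EuclideanSpace ℝ (Fin D)} {L : ℝ}
    (hL : L ∈ curveLengths M x q) :
    ‖x - q‖ ≤ L ∧ ‖(submanifoldTangent M q)ᗮ.starProjection (x - q)‖ ≤ κ / 2 * L ^ 2 := by
  obtain ⟨γ, hγ, hγM, rfl, rfl, rfl⟩ := hL
  -- The curve is reversed so that it starts at `q`, where the tangent space is taken.
  have hmaps : Set.MapsTo (fun t : ℝ => 1 - t) (Set.Icc 0 1) (Set.Icc 0 1) := fun t ht => by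
    simp only [Set.mem_Icc] at ht ⊢; constructor <;> linarith [ht.1, ht.2]
  have hd : ContinuousOn (fun t => ‖derivWithin γ (Set.Icc 0 1) t‖) (Set.Icc 0 1) :=
    (hγ.continuousOn_derivWithin (uniqueDiffOn_Icc zero_lt_one) le_rfl).norm
  obtain ⟨u, hu, hueq⟩ : ∃ u : ℝ → ℝ, Continuous u ∧
      ∀ t ∈ Set.Icc (0 : ℝ) 1, u t = ‖derivWithin γ (Set.Icc 0 1) (1 - t)‖ :=
    ⟨_, (continuousOn_iff_continuous_domRestrict.1 (hd.comp (by fun_prop) hmaps)).Icc_extend'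
      (h := zero_le_one), fun t ht => by rw [Set.IccExtend_of_mem _ _ ht]; rfl⟩
  have hint : ∫ t in (0 : ℝ)..1, u t = ∫ t in (0 : ℝ)..1, ‖derivWithin γ (Set.Icc 0 1) t‖ := by
    have h1 : ∫ t in (0 : ℝ)..1, u t =
        ∫ t in (0 : ℝ)..1, ‖derivWithin γ (Set.Icc 0 1) (1 - t)‖ :=
      intervalIntegral.integral_congr fun t ht => hueq t (by rwa [Set.uIcc_of_le zero_le_one] at ht)
    rw [h1, intervalIntegral.integral_comp_sub_left
      (fun t => ‖derivWithin γ (Set.Icc 0 1) t‖) 1, sub_self, sub_zero]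
  have hd : ∀ t ∈ Set.Icc (0 : ℝ) 1, HasDerivWithinAt (fun t => γ (1 - t))
      (-derivWithin γ (Set.Icc 0 1) (1 - t)) (Set.Icc 0 1) t := fun t ht => by
    have h1 := (hγ.differentiableOn one_ne_zero (1 - t) (hmaps ht)).hasDerivWithinAt
    have h2 : HasDerivWithinAt (fun t : ℝ => 1 - t) (-1) (Set.Icc 0 1) t :=
      ((hasDerivAt_id t).const_sub 1).hasDerivWithinAt
    have h3 := h1.scomp t h2 hmaps
    rw [neg_one_smul] at h3
    exact h3
  have key := norm_sub_le_and_norm_normal_le hM hκ hd (fun t ht => hγM _ (hmaps ht)) hu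
    (fun t ht => by rw [hueq t ht, norm_neg])
  simpa [hint] using key

/-- A substitute for the geodesic with initial velocity `v`. -/
theorem infDist_add_tangent_le (hM : IsSmoothSubmanifold d M) (hcompact : IsCompact M)
    (hκ : ExtrinsicCurvatureBounded M κ) (hκ0 : 0 ≤ κ) {q v : EuclideanSpace ℝ (Fin D)}
    (hq : q ∈ M) (hv : v ∈ submanifoldTangent M q) :
    Metric.infDist (q + v) M ≤ κ / 2 * ‖v‖ ^ 2 := by
  set P : EuclideanSpace ℝ (Fin D) → EuclideanSpace ℝ (Fin D) →L[ℝ] EuclideanSpace ℝ (Fin D) :=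
    fun y => (submanifoldTangent M y).starProjection with hPdef
  have hPc : ContinuousOn P M := fun y hy => by
    obtain ⟨B, hB, -⟩ := hM.exists_hasFDerivWithinAt_starProjection hκ hy
    exact hB.continuousWithinAt
  suffices h : ∀ ε > 0, Metric.infDist (q + v) M ≤ κ / 2 * ‖v‖ ^ 2 + ε * (1 + ‖v‖) by
    refine le_of_forall_pos_le_add fun δ hδ => ?_
    have := h (δ / (1 + ‖v‖)) (by positivity)
    rwa [div_mul_cancel₀ _ (by positivity)] at this
  intro ε hε
  -- `K` holds the states reachable by approximate solutions of `y' = P y v`, `y 0 = q`. Such a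
  -- solution has speed at most `‖v‖`, so `P y` turns by at most `κ * ‖v‖ * t`; then `y' - v = (P y
  -- - P q) v` integrates to `κ / 2 * t ^ 2 * ‖v‖ ^ 2`. The `ε` terms absorb the errors of Euler
  -- steps.
  set K : Set (ℝ × EuclideanSpace ℝ (Fin D)) := {p | p ∈ Set.Icc (0 : ℝ) 1 ×ˢ M ∧
    ‖p.2 - q - p.1 • v‖ ≤ κ / 2 * p.1 ^ 2 * ‖v‖ ^ 2 + ε * (1 + ‖v‖) * p.1 ∧
    ‖P p.2 - P q‖ ≤ (κ * ‖v‖ + ε) * p.1} with hK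
  have hKc : IsCompact K := by
    have hc : IsCompact (Set.Icc (0 : ℝ) 1 ×ˢ M) := isCompact_Icc.prod hcompact
    have hf : ContinuousOn (fun p : ℝ × EuclideanSpace ℝ (Fin D) =>
        (κ / 2 * p.1 ^ 2 * ‖v‖ ^ 2 + ε * (1 + ‖v‖) * p.1 - ‖p.2 - q - p.1 • v‖,
          (κ * ‖v‖ + ε) * p.1 - ‖P p.2 - P q‖)) (Set.Icc (0 : ℝ) 1 ×ˢ M) := by
      refine ContinuousOn.prodMk (by fun_prop) (ContinuousOn.sub (by fun_prop) ?_)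
      exact ((hPc.comp continuousOn_snd fun p hp => hp.2).sub continuousOn_const).norm
    refine hc.of_isClosed_subset ?_ fun p hp => hp.1
    have := hf.preimage_isClosed_of_isClosed hc.isClosed (isClosed_Ici (a := ((0 : ℝ), (0 : ℝ))))
    convert this using 1
    ext p
    simp [hK, Prod.le_def]
  set A : Set ℝ := Prod.fst '' K
  -- Continuous induction on time: compactness of `K` makes the set of times closed, and a short
  -- step along a curve with velocity `P y v` extends it.
  have hA : Set.Icc (0 : ℝ) 1 ⊆ A := by
    refine IsClosed.Icc_subset_of_forall_exists_gt
      ((hKc.image continuous_fst).isClosed.inter isClosed_Icc)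
      ⟨(0, q), ⟨⟨by simp, hq⟩, by simp, by simp⟩, rfl⟩ ?_
    rintro _ ⟨⟨⟨t, y⟩, ⟨⟨ht, hy⟩, h1, h2⟩, rfl⟩, ht'⟩ s hs
    simp only at ht hy h1 h2 ht' hs ⊢
    obtain ⟨B, hB, hBle⟩ := hM.exists_hasFDerivWithinAt_starProjection hκ hy
    have hw : P y v ∈ submanifoldTangent M y := Submodule.starProjection_apply_mem _ _
    obtain ⟨c, rfl, hcM, hc⟩ := hM.exists_curve hy hw
    have hPd : HasDerivAt (fun r => P (c r)) (B (P (c 0) v)) 0 := hB.comp_hasDerivAt 0 hc hcM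
    have e1 := (hasDerivAt_iff_isLittleO.1 hc).def hε
    have e2 := (hasDerivAt_iff_isLittleO.1 hPd).def hε
    have e3 : ∀ᶠ r in 𝓝 (0 : ℝ), r < min (s - t) (1 - t) :=
      gt_mem_nhds (lt_min (sub_pos.2 hs) (sub_pos.2 ht'.2))
    obtain ⟨r, ⟨⟨⟨hr1, hr2⟩, hr3⟩, hrM⟩, hr0⟩ :=
      ((((e1.and e2).and e3).and hcM).filter_mono nhdsWithin_le_nhds |>.and
        (self_mem_nhdsWithin (a := (0 : ℝ)) (s := Set.Ioi 0))).exists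
    have hr0 : 0 < r := hr0
    have hrs := hr3.trans_le (min_le_left _ _)
    have hr1t := hr3.trans_le (min_le_right _ _)
    rw [sub_zero, Real.norm_of_nonneg hr0.le] at hr1 hr2
    refine ⟨t + r, ⟨(t + r, c r), ⟨⟨⟨by linarith [ht.1], by linarith⟩, hrM⟩, ?_, ?_⟩, rfl⟩,
      by linarith, by linarith⟩
    · have hwv : ‖P (c 0) v - v‖ ≤ κ * ‖v‖ ^ 2 * t + ε * ‖v‖ := by
        have : P (c 0) v - v = (P (c 0) - P q) v := by
          rw [sub_apply]
          congr 1
          exact (Submodule.starProjection_eq_self_iff.2 hv).symm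
        rw [this]
        refine (ContinuousLinearMap.le_of_opNorm_le _ h2 v).trans ?_
        have : ε * ‖v‖ * t ≤ ε * ‖v‖ * 1 := by gcongr; exact ht.2
        linarith
      have hdec : c r - q - (t + r) • v = (c 0 - q - t • v) + (c r - c 0 - r • P (c 0) v) +
          r • (P (c 0) v - v) := by
        rw [add_smul, smul_sub]; abel
      simp only
      rw [hdec]
      refine (norm_add₃_le).trans ?_
      rw [norm_smul, Real.norm_of_nonneg hr0.le]
      have := mul_le_mul_of_nonneg_left hwv hr0.le
      -- The slack left when `t ^ 2 + 2 * t * r` is replaced by `(t + r) ^ 2`.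
      have : 0 ≤ κ / 2 * r ^ 2 * ‖v‖ ^ 2 := by positivity
      linarith
    · have hw' : ‖B (P (c 0) v)‖ ≤ κ * ‖v‖ := by
        refine (hBle _ hw).trans ?_
        gcongr
        exact Submodule.norm_starProjection_apply_le _ _
      have hdec : P (c r) - P q = (P (c 0) - P q) + (P (c r) - P (c 0) - r • B (P (c 0) v)) +
          r • B (P (c 0) v) := by abel
      simp only
      rw [hdec]
      refine (norm_add₃_le).trans ?_
      rw [norm_smul, Real.norm_of_nonneg hr0.le]
      have := mul_le_mul_of_nonneg_left hw' hr0.le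
      linarith
  obtain ⟨⟨t, y⟩, ⟨⟨-, hy⟩, h1, -⟩, rfl⟩ := hA (Set.right_mem_Icc.2 zero_le_one)
  refine (Metric.infDist_le_dist_of_mem hy).trans ?_
  rw [dist_comm, dist_eq_norm]
  simpa [sub_sub] using h1

end Curves

/-! ### Joining points by `C¹` curves, passage to the infimum, and the final estimate. -/

section Joining

variable {D d : ℕ} {M : Set (EuclideanSpace ℝ (Fin D))} {κ : ℝ}

/-- `x` and `y` are joined by a `C¹` curve in `M` that rests at `x` before time `0` and at `y`
after time `1`. -/
def JoinedByC1 (M : Set (EuclideanSpace ℝ (Fin D))) (x y : EuclideanSpace ℝ (Fin D)) : Prop :=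
  ∃ γ : ℝ → EuclideanSpace ℝ (Fin D), ContDiff ℝ 1 γ ∧ (∀ t, γ t ∈ M) ∧
    (∀ t ≤ 0, γ t = x) ∧ ∀ t, 1 ≤ t → γ t = y

theorem JoinedByC1.symm {x y : EuclideanSpace ℝ (Fin D)} (h : JoinedByC1 M x y) :
    JoinedByC1 M y x := by
  obtain ⟨γ, hγ, hM, h0, h1⟩ := h
  exact ⟨fun t => γ (1 - t), hγ.comp (by fun_prop), fun t => hM _,
    fun t ht => h1 _ (by linarith), fun t ht => h0 _ (by linarith)⟩

theorem JoinedByC1.trans {x y z : EuclideanSpace ℝ (Fin D)} (h : JoinedByC1 M x y)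
    (h' : JoinedByC1 M y z) : JoinedByC1 M x z := by
  obtain ⟨γ, hγ, hM, h0, h1⟩ := h
  obtain ⟨η, hη, hM', h0', h1'⟩ := h'
  have hl : ∀ t : ℝ, 2 * t ≤ 1 → γ (2 * t) + η (2 * t - 1) - y = γ (2 * t) := fun t ht => by
    rw [h0' _ (by linarith), add_sub_cancel_right]
  have hr : ∀ t : ℝ, 1 ≤ 2 * t → γ (2 * t) + η (2 * t - 1) - y = η (2 * t - 1) := fun t ht => by
    rw [h1 _ ht, add_sub_cancel_left]
  -- While one curve moves the other rests at `y`, so the sum concatenates them and is visibly `C¹`.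
  refine ⟨fun t => γ (2 * t) + η (2 * t - 1) - y,
    ((hγ.comp (by fun_prop)).add (hη.comp (by fun_prop))).sub contDiff_const,
    fun t => ?_, fun t ht => ?_, fun t ht => ?_⟩
  · rcases le_total (2 * t) 1 with ht | ht
    · simp only [hl t ht, hM]
    · simp only [hr t ht, hM']
  · exact (hl t (by linarith)).trans (h0 _ (by linarith))
  · exact (hr t (by linarith)).trans (h1' _ (by linarith))

theorem IsSliceChart.eventually_joinedByC1
    {e : OpenPartialHomeomorph (EuclideanSpace ℝ (Fin D)) (EuclideanSpace ℝ (Fin D))}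
    {V : Submodule ℝ (EuclideanSpace ℝ (Fin D))} {x : EuclideanSpace ℝ (Fin D)}
    (h : IsSliceChart M e V) (hxM : x ∈ M) (hx : x ∈ e.source) :
    ∀ᶠ y in 𝓝[M] x, JoinedByC1 M x y := by
  obtain ⟨r, hr, hball⟩ := Metric.isOpen_iff.1 e.open_target (e x) (e.map_source hx)
  have h1 : ∀ᶠ y in 𝓝[M] x, e y ∈ Metric.ball (e x) r :=
    nhdsWithin_le_nhds ((e.continuousAt hx) (Metric.ball_mem_nhds _ hr))
  have h2 : ∀ᶠ y in 𝓝[M] x, y ∈ e.source := nhdsWithin_le_nhds (e.open_source.mem_nhds hx)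
  filter_upwards [h1, h2, self_mem_nhdsWithin] with y hy1 hy2 hyM
  have hmem : ∀ t : ℝ, e x + Real.smoothTransition t • (e y - e x) ∈ e.target := fun t =>
    hball ((convex_ball (e x) r).add_smul_sub_mem (Metric.mem_ball_self hr) hy1
      ⟨Real.smoothTransition.nonneg t, Real.smoothTransition.le_one t⟩)
  -- The smooth transition makes the chart segment constant outside `[0, 1]`.
  refine ⟨fun t => e.symm (e x + Real.smoothTransition t • (e y - e x)), ?_, fun t => ?_,
    fun t ht => ?_, fun t ht => ?_⟩
  · refine (h.contDiffOn_symm.of_le (by norm_cast)).comp_contDiff ?_ hmem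
    exact contDiff_const.add (Real.smoothTransition.contDiff.smul contDiff_const)
  · have hxV := (h.mem_iff x hx).1 hxM
    exact h.symm_mem (hmem t)
      (V.add_mem hxV (V.smul_mem _ (V.sub_mem ((h.mem_iff y hy2).1 hyM) hxV)))
  · simp [Real.smoothTransition.zero_of_nonpos ht, e.left_inv hx]
  · simp [Real.smoothTransition.one_of_one_le ht, e.left_inv hy2]

theorem IsSmoothSubmanifold.joinedByC1 (hM : IsSmoothSubmanifold d M) (hconn : IsConnected M)
    {x y : EuclideanSpace ℝ (Fin D)} (hx : x ∈ M) (hy : y ∈ M) : JoinedByC1 M x y := by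
  refine hconn.isPreconnected.induction₂ (JoinedByC1 M) (fun x hx => ?_)
    (fun _ _ _ _ _ _ h h' => h.trans h') (fun _ _ _ _ h => h.symm) hx hy
  obtain ⟨e, V, h, hs⟩ := hM.exists_isSliceChart hx
  exact h.eventually_joinedByC1 hx hs

theorem IsSmoothSubmanifold.curveLengths_nonempty (hM : IsSmoothSubmanifold d M)
    (hconn : IsConnected M) {x y : EuclideanSpace ℝ (Fin D)} (hx : x ∈ M) (hy : y ∈ M) :
    (curveLengths M x y).Nonempty := by
  obtain ⟨γ, hγ, hγM, h0, h1⟩ := hM.joinedByC1 hconn hx hy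
  exact ⟨_, γ, hγ.contDiffOn, fun t _ => hγM t, h0 0 le_rfl, h1 1 le_rfl, rfl⟩

theorem norm_normal_le_intrinsicDist (hM : IsSmoothSubmanifold d M) (hconn : IsConnected M)
    (hκ : ExtrinsicCurvatureBounded M κ) {x q : EuclideanSpace ℝ (Fin D)} (hx : x ∈ M)
    (hq : q ∈ M) :
    ‖x - q‖ ≤ intrinsicDist M x q ∧
      ‖(submanifoldTangent M q)ᗮ.starProjection (x - q)‖ ≤ κ / 2 * intrinsicDist M x q ^ 2 := by
  have hne := hM.curveLengths_nonempty hconn hx hq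
  have hlow : ∀ L ∈ curveLengths M x q, ‖x - q‖ ≤ L := fun L hL =>
    (norm_sub_le_of_mem_curveLengths hM hκ hL).1
  refine ⟨le_csInf hne hlow, ?_⟩
  -- The infimum need not be known to be attained: the bound is a closed condition on `L`.
  have hcl : IsClosed {L : ℝ | ‖(submanifoldTangent M q)ᗮ.starProjection (x - q)‖ ≤
      κ / 2 * L ^ 2} := isClosed_le (by fun_prop) (by fun_prop)
  exact closure_minimal (fun L hL => (norm_sub_le_of_mem_curveLengths hM hκ hL).2) hcl
    (csInf_mem_closure hne ⟨_, hlow⟩)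

/-- A norm is bounded by `κ / 2` times the squared distance, which is impossible for `κ < 0` unless
the distance vanishes. -/
theorem intrinsicDist_eq_zero_of_curvature_neg (hM : IsSmoothSubmanifold d M)
    (hconn : IsConnected M) (hκ : ExtrinsicCurvatureBounded M κ) (hneg : κ < 0)
    {x q : EuclideanSpace ℝ (Fin D)} (hx : x ∈ M) (hq : q ∈ M) : intrinsicDist M x q = 0 := by
  have hb := norm_normal_le_intrinsicDist hM hconn hκ hx hq
  have h1 : 0 ≤ κ / 2 * intrinsicDist M x q ^ 2 := (norm_nonneg _).trans hb.2
  have h2 : intrinsicDist M x q ^ 2 ≤ 0 := by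
    by_contra! h
    nlinarith
  exact pow_eq_zero_iff two_ne_zero |>.1 (le_antisymm h2 (sq_nonneg _))

theorem infDist_mean_le_of_nonneg (hM : IsSmoothSubmanifold d M) (hcompact : IsCompact M)
    (hκ : ExtrinsicCurvatureBounded M κ) (hκ0 : 0 ≤ κ) {N : ℕ} (hN : 1 ≤ N)
    {x : Fin N → EuclideanSpace ℝ (Fin D)} {δ : Fin N → ℝ} {q : EuclideanSpace ℝ (Fin D)}
    (hq : q ∈ M) (hδ : ∀ i, ‖x i - q‖ ≤ δ i)
    (hδ' : ∀ i, ‖(submanifoldTangent M q)ᗮ.starProjection (x i - q)‖ ≤ κ / 2 * δ i ^ 2) :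
    Metric.infDist ((1 / (N : ℝ)) • ∑ i, x i) M ≤ κ / N * ∑ i, δ i ^ 2 := by
  have hN0 : (0 : ℝ) < N := by exact_mod_cast hN
  set T := submanifoldTangent M q
  set v := (1 / (N : ℝ)) • ∑ i, T.starProjection (x i - q) with hv
  have hvT : v ∈ T :=
    T.smul_mem _ (T.sum_mem fun i _ => Submodule.starProjection_apply_mem _ _)
  have hmean : (1 / (N : ℝ)) • ∑ i, x i - (q + v) =
      (1 / (N : ℝ)) • ∑ i, Tᗮ.starProjection (x i - q) := by
    simp only [Submodule.starProjection_orthogonal_val, Finset.sum_sub_distrib, smul_sub, hv,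
      Finset.sum_const, Finset.card_univ, Fintype.card_fin]
    rw [← Nat.cast_smul_eq_nsmul ℝ, smul_smul, one_div_mul_cancel hN0.ne', one_smul]
    abel
  have hdist : dist ((1 / (N : ℝ)) • ∑ i, x i) (q + v) ≤ 1 / N * (κ / 2 * ∑ i, δ i ^ 2) := by
    rw [dist_eq_norm, hmean, norm_smul, Real.norm_of_nonneg (by positivity), Finset.mul_sum]
    gcongr
    exact norm_sum_le_of_le _ fun i _ => hδ' i
  have hvle : ‖v‖ ≤ 1 / N * ∑ i, δ i := by
    rw [hv, norm_smul, Real.norm_of_nonneg (by positivity)]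
    gcongr
    exact norm_sum_le_of_le _ fun i _ =>
      (Submodule.norm_starProjection_apply_le _ _).trans (hδ i)
  have hv2 : ‖v‖ ^ 2 ≤ 1 / N * ∑ i, δ i ^ 2 := by
    have h1 := sq_sum_le_card_mul_sum_sq (s := Finset.univ) (f := δ)
    rw [Finset.card_univ, Fintype.card_fin] at h1
    calc ‖v‖ ^ 2 ≤ (1 / N * ∑ i, δ i) ^ 2 := by gcongr
      _ = (1 / N) ^ 2 * (∑ i, δ i) ^ 2 := by ring
      _ ≤ (1 / N) ^ 2 * (N * ∑ i, δ i ^ 2) := by gcongr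
      _ = 1 / N * ∑ i, δ i ^ 2 := by field_simp
  calc Metric.infDist ((1 / (N : ℝ)) • ∑ i, x i) M
      ≤ Metric.infDist (q + v) M + dist ((1 / (N : ℝ)) • ∑ i, x i) (q + v) :=
        Metric.infDist_le_infDist_add_dist
    _ ≤ κ / 2 * ‖v‖ ^ 2 + 1 / N * (κ / 2 * ∑ i, δ i ^ 2) :=
        add_le_add (infDist_add_tangent_le hM hcompact hκ hκ0 hq hvT) hdist
    _ ≤ κ / 2 * (1 / N * ∑ i, δ i ^ 2) + 1 / N * (κ / 2 * ∑ i, δ i ^ 2) := by gcongr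
    _ = κ / N * ∑ i, δ i ^ 2 := by ring

end Joining

theorem mainTheorem5 (D d : ℕ) (M : Set (EuclideanSpace ℝ (Fin D))) (κ : ℝ)
    (hM : IsSmoothSubmanifold d M) (hcompact : IsCompact M) (hconn : IsConnected M)
    (hκ : ExtrinsicCurvatureBounded M κ)
    (N : ℕ) (hN : 1 ≤ N) (x : Fin N → EuclideanSpace ℝ (Fin D)) (hx : ∀ i, x i ∈ M)
    (q : EuclideanSpace ℝ (Fin D)) (hq : q ∈ M) :
    Metric.infDist ((1 / (N : ℝ)) • ∑ i, x i) M ≤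
      κ / N * ∑ i, intrinsicDist M (x i) q ^ 2 := by
  have hb := fun i => norm_normal_le_intrinsicDist hM hconn hκ (hx i) hq
  rcases le_or_gt 0 κ with h0 | hneg
  · exact infDist_mean_le_of_nonneg hM hcompact hκ h0 hN hq (fun i => (hb i).1) fun i => (hb i).2
  -- For `κ < 0` every `x i` equals `q`, and both sides are zero.
  · have hd := fun i => intrinsicDist_eq_zero_of_curvature_neg hM hconn hκ hneg (hx i) hq
    have hxq : ∀ i, x i = q := fun i => by
      have h := (hb i).1
      rw [hd i] at h
      exact sub_eq_zero.1 (norm_le_zero_iff.1 h)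
    have hN0 : (N : ℝ) ≠ 0 := by exact_mod_cast (Nat.one_le_iff_ne_zero.1 hN)
    have hmean : (1 / (N : ℝ)) • ∑ i, x i = q := by
      simp only [hxq, Finset.sum_const, Finset.card_univ, Fintype.card_fin]
      rw [← Nat.cast_smul_eq_nsmul ℝ, smul_smul, one_div_mul_cancel hN0, one_smul]
    rw [hmean]
    simp [hd, Metric.infDist_zero_of_mem hq]
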